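/- All graphs are finite and simple and all logarithms are to base $2$. For integers $t,m$ let $R(t,m)$ be the least $n$ such that every graph on $n$ vertices contains a clique $K_t$ or an independent set of size $m$, and for $t\ge 2$ let $Q(t,n)$ be the minimum independence number of a $K_t$-free graph on $n$ vertices. For a graph $H$ and real $x$ let $RT(n,H,x)$ be the maximum number of edges of an $H$-free graph on $n$ vertices with independence number less than $x$ (and $0$ if there is no such graph). For $f:\mathbb N\to\mathbb R$ put $$\overline{RT}(H,f)=\limsup_{n\to\infty}\frac{RT(n,H,f(n))}{n^2},\qquad \underline{RT}(H,f)=\liminf_{n\to\infty}\frac{RT(n,H,f(n))}{n^2}.$$ We say that $H$ has a phase transition from $f$ to $g$ if $\overline{RT}(H,g)<\underline{RT}(H,f)$. (The notion is meant for $g\le f$, but this is not required, so "no phase transition" always means $\overline{RT}(H,g)\ge\underline{RT}(H,f)$.) For $\varphi(n)\to0$, $H$ has a $\varphi$-phase-transition at $f$ if it has a phase transition from $f$ to $\varphi f$. $H$ has a weak phase transition at $f$ if for some $\varepsilon>0$ it has a $\varphi$-phase-transition at $f$ with $\varphi(n)=2^{-(\log n)^{1-\varepsilon}}$, where in particular $\varphi(n)\to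 0$. **Theorem.** Let $s\ge 0$ and $t\ge 2$ be integers. Assume that there exist $\vartheta>0$ and $N>0$ such that $$R(t,n)\le \frac{R(t+1,n)}{n^{\vartheta}}\qquad\text{for all } n>N,$$ and that $K_s$ has a phase transition from $Q(t,n)$ to $Q(t+1,n)$. Then there exists $\varepsilon\in(0,1)$ such that for every function $\omega(n)\to\infty$, with $\varphi_\varepsilon(n)=2^{-\omega(n)(\log n)^{1-\varepsilon}}$, the graph $K_s$ has a $\varphi_\varepsilon$-phase-transition at $Q(t,n)$, and $K_s$ has no phase transition from $\varphi_\varepsilon(n)\,Q(t,n)$ to $Q(t+1,n)$. Moreover, $K_s$ has a weak phase transition at $Q(t,n)$. -/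

import Mathlib

open Filter Topology

/-- The Ramsey number `R(t, m)`: the least `n` such that every graph on `n` vertices contains a
clique on `t` vertices or an independent set of size `m`. -/
noncomputable def ramseyR (t m : ℕ) : ℕ :=
  sInf {n : ℕ | ∀ G : SimpleGraph (Fin n),
    (∃ S : Finset (Fin n), G.IsNClique t S) ∨ (∃ S : Finset (Fin n), G.IsNIndepSet m S)}

/-- The inverse Ramsey function `Q(t, n)`: the least independence number of a `K_t`-free graph on
`n` vertices. For `t ≥ 2` such graphs exist for every `n`. -/
noncomputable def ramseyQ (t n : ℕ) : ℕ :=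
  sInf {a : ℕ | ∃ G : SimpleGraph (Fin n), G.CliqueFree t ∧ G.indepNum = a}

/-- The polynomial gap between consecutive Ramsey numbers at `l` (meant for `l ≥ 3`): there are
`θ > 0` and `N > 0` with `R(l - 1, n) ≤ R(l, n) / n ^ θ` for all `n > N`. -/
def RamseyGap (l : ℕ) : Prop :=
  ∃ θ : ℝ, 0 < θ ∧ ∃ N : ℕ, 0 < N ∧ ∀ n : ℕ, N < n →
    (ramseyR (l - 1) n : ℝ) ≤ (ramseyR l n : ℝ) / (n : ℝ) ^ θ

/-- The Ramsey–Turán function `RT(n, H, x)`: the maximum number of edges of an `H`-free graph on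
`n` vertices with independence number less than `x`; it is `0` if there is no such graph. -/
noncomputable def ramseyTuran {V : Type*} (n : ℕ) (H : SimpleGraph V) (x : ℝ) : ℕ :=
  sSup {e : ℕ | ∃ G : SimpleGraph (Fin n),
    H.Free G ∧ (G.indepNum : ℝ) < x ∧ G.edgeSet.ncard = e}

/-- The upper Ramsey–Turán density of `H` with respect to `f`. The sequence has its values in
`[0, 1/2]`, so the real `limsup` is the usual one. -/
noncomputable def upperRTDensity {V : Type*} (H : SimpleGraph V) (f : ℕ → ℝ) : ℝ :=
  limsup (fun n : ℕ => (ramseyTuran n H (f n) : ℝ) / (n : ℝ) ^ 2) atTop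

/-- The lower Ramsey–Turán density of `H` with respect to `f`. -/
noncomputable def lowerRTDensity {V : Type*} (H : SimpleGraph V) (f : ℕ → ℝ) : ℝ :=
  liminf (fun n : ℕ => (ramseyTuran n H (f n) : ℝ) / (n : ℝ) ^ 2) atTop

/-- `H` has a phase transition from `f` to `g`. The notion is meant for functions `g ≤ f`; the
inequality is not a conjunct here, so that the negation always says that the densities do not
drop and never holds merely because `g ≤ f` fails. -/
def HasPhaseTransition {V : Type*} (H : SimpleGraph V) (f g : ℕ → ℝ) : Prop :=
  upperRTDensity H g < lowerRTDensity H f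

/-- `H` has a `φ`-phase-transition at `f`, where `φ n → 0`. -/
def HasPhiPhaseTransition {V : Type*} (H : SimpleGraph V) (φ f : ℕ → ℝ) : Prop :=
  Tendsto φ atTop (𝓝 0) ∧ HasPhaseTransition H f (fun n => φ n * f n)

/-- `H` has a weak phase transition at `f`: for some `ε > 0` it has a `φ`-phase-transition at `f`
with `φ n = 2 ^ (-(log₂ n) ^ (1 - ε))`. -/
def HasWeakPhaseTransition {V : Type*} (H : SimpleGraph V) (f : ℕ → ℝ) : Prop :=
  ∃ ε : ℝ, 0 < ε ∧
    HasPhiPhaseTransition H (fun n : ℕ => (2 : ℝ) ^ (-((Real.logb 2 (n : ℝ)) ^ (1 - ε)))) f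

/-- The function `φ_ε(n) = 2 ^ (-ω(n) (log₂ n) ^ (1 - ε))`. -/
noncomputable def phiEps (ω : ℕ → ℝ) (ε : ℝ) (n : ℕ) : ℝ :=
  (2 : ℝ) ^ (-(ω n * (Real.logb 2 (n : ℝ)) ^ (1 - ε)))

/-! Let k = ⌊(s-1)/t⌋, so that kt < s ≤ (k+1)t. Two bounds meet at half the Turán density, (1 -
1/k)/2.

From below: the complete join of k extremal K_{t+1}-free graphs has clique number at most kt < s,
and its independent sets stay inside one copy. Hence the upper density at Q(t+1, n) is at least (1 -
1/k)/2 (`le_upperRTDensity_ramseyQ`).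

From above: if φ(n) is eventually below 2^{-A (log n)^{1-1/(k+1)}} for every A, the upper density at
φ Q(t, n) is at most (1 - 1/k)/2 (`upperRTDensity_le_of_small`). More edges would force a positive
density of K_{k+1} (`exists_clique_density`), and k+1 rounds of dependent random choice turn these
into k+1 completely joined t-cliques (`exists_prod_cliques_subset`), hence a K_s. Each round must
find a t-clique in a set of n 2^{-O((log n)^{1-1/(k+1)})} vertices; subadditivity of Q(t, ·)
provides it (`exists_isNClique_subset_of_indepNum_lt`).

With ε = 1/(k+1) this gives upper(φ Q(t)) ≤ (1 - 1/k)/2 ≤ upper(Q(t+1)) < lower(Q(t)). The two ends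
are the transition at Q(t, n); the first two inequalities rule out a further drop. -/

/-! ### Dependent random choice and products of cliques -/

open Finset in
/-- Dependent random choice: a bipartite relation of density `δ` admits a large set `U` all of whose
`t`-subsets have a common neighbourhood of density at least `δ'`. -/
theorem exists_large_subset_of_dense {V W : Type*} [Fintype V] [Fintype W] [Nonempty V] [Nonempty W]
    (R : V → W → Prop) {δ δ' : ℝ} (hδ : 0 ≤ δ) (hδ' : 0 ≤ δ') {q t : ℕ} (hq : 1 ≤ q) (ht : 1 ≤ t)
    (hR : δ * (Fintype.card V * Fintype.card W) ≤ Nat.card {p : V × W // R p.1 p.2})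
    (hV : (Fintype.card V : ℝ) ^ t * δ' ^ q ≤ 1) :
    ∃ U : Finset V, δ ^ q * Fintype.card V - 1 ≤ #U ∧
      ∀ T ⊆ U, #T = t → δ' * Fintype.card W ≤ Nat.card {w : W // ∀ v ∈ T, R v w} := by
  classical
  set n : ℝ := (Fintype.card V : ℝ) with hn
  set N : ℝ := (Fintype.card W : ℝ) with hN
  have hn0 : 0 < n := by rw [hn]; exact_mod_cast Fintype.card_pos
  have hN0 : 0 < N := by rw [hN]; exact_mod_cast Fintype.card_pos
  -- Sample q points of W with repetition. `A w` is their common neighbourhood, and `B w` collects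
  -- its t-subsets with too few common neighbours. Sums over w replace expectations.
  let A : (Fin q → W) → Finset V := fun w => {v | ∀ i, R v (w i)}
  let common : Finset V → Finset W := fun T => {w | ∀ v ∈ T, R v w}
  let bad : Finset (Finset V) := {T ∈ powersetCard t univ | (#(common T) : ℝ) < δ' * N}
  let B : (Fin q → W) → Finset (Finset V) := fun w => {T ∈ bad | T ⊆ A w}
  have hpow : ∀ S : Finset W, #{w : Fin q → W | ∀ i, w i ∈ S} = #S ^ q := by
    intro S
    rw [← Fintype.card_piFinset_const S q]
    congr 1
    ext w
    simp
  have hA : ∑ w, (#(A w) : ℝ) = ∑ v, (#{w | R v w} : ℝ) ^ q := by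
    have h1 : ∑ w, #(A w) = ∑ v, #{w | R v w} ^ q := by
      have := sum_card_bipartiteAbove_eq_sum_card_bipartiteBelow (s := (univ : Finset (Fin q → W)))
        (t := (univ : Finset V)) (fun w v => ∀ i, R v (w i))
      simp only [bipartiteAbove, bipartiteBelow] at this
      rw [this]
      refine sum_congr rfl fun v _ => ?_
      rw [← hpow]
      simp
    exact_mod_cast h1
  -- At most one bad t-set is expected: there are at most n^t of them, each lies in `A w` with
  -- probability at most δ'^q, and `hV` bounds the product by 1.
  have hB : ∑ w, (#(B w) : ℝ) ≤ N ^ q := by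
    have h1 : ∑ w, #(B w) = ∑ T ∈ bad, #(common T) ^ q := by
      have := sum_card_bipartiteAbove_eq_sum_card_bipartiteBelow (s := (univ : Finset (Fin q → W)))
        (t := bad) (fun w T => T ⊆ A w)
      simp only [bipartiteAbove, bipartiteBelow] at this
      rw [this]
      refine sum_congr rfl fun T _ => ?_
      rw [← hpow]
      congr 1
      ext w
      simp only [A, common, subset_iff, mem_filter, mem_univ, true_and]
      exact ⟨fun h i v hv => h hv i, fun h v hv i => h i v hv⟩
    have h2 : ∑ w, (#(B w) : ℝ) = ∑ T ∈ bad, (#(common T) : ℝ) ^ q := by exact_mod_cast h1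
    rw [h2]
    calc ∑ T ∈ bad, (#(common T) : ℝ) ^ q ≤ ∑ T ∈ bad, (δ' * N) ^ q := by
          refine sum_le_sum fun T hT => ?_
          have := (mem_filter.1 hT).2
          gcongr
      _ = #bad * (δ' * N) ^ q := by rw [sum_const, nsmul_eq_mul]
      _ ≤ n ^ t * (δ' * N) ^ q := by
          gcongr
          have h3 : #bad ≤ (Fintype.card V) ^ t := by
            refine (card_le_card (filter_subset _ _)).trans ?_
            rw [card_powersetCard]
            exact Nat.choose_le_pow _ _
          rw [hn]
          exact_mod_cast h3
      _ = (n ^ t * δ' ^ q) * N ^ q := by ring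
      _ ≤ 1 * N ^ q := by gcongr
      _ = N ^ q := one_mul _
  have hE : (Nat.card {p : V × W // R p.1 p.2} : ℝ) = ∑ v, (#{w | R v w} : ℝ) := by
    rw [Nat.card_eq_fintype_card, Fintype.card_subtype]
    have : #{p : V × W | R p.1 p.2} = ∑ v, #{w | R v w} := by
      simp only [card_filter]
      rw [Fintype.sum_prod_type]
    exact_mod_cast this
  -- Convexity of x^q. The power-mean lemma has exponent p + 1, whence q = p + 1.
  have hJ : n * (δ * N) ^ q ≤ ∑ v, (#{w | R v w} : ℝ) ^ q := by
    obtain ⟨p, rfl⟩ : ∃ p, q = p + 1 := ⟨q - 1, by omega⟩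
    have h1 := pow_sum_div_card_le_sum_pow (s := (univ : Finset V)) (f := fun v => (#{w | R v w} : ℝ))
      (n := p) (fun _ _ => by positivity)
    refine le_trans ?_ h1
    rw [card_univ, ← hn, le_div_iff₀ (by positivity)]
    calc n * (δ * N) ^ (p + 1) * n ^ p = (δ * (n * N)) ^ (p + 1) := by ring
      _ ≤ _ := by
        rw [← hE]
        gcongr
  have hsum : ∑ w : Fin q → W, (δ ^ q * n - 1) ≤ ∑ w, ((#(A w) : ℝ) - #(B w)) := by
    rw [sum_sub_distrib (fun w => (#(A w) : ℝ)), hA, sum_const, card_univ, Fintype.card_fun, Fintype.card_fin, nsmul_eq_mul]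
    push_cast
    rw [← hN]
    have : N ^ q * (δ ^ q * n - 1) = n * (δ * N) ^ q - N ^ q := by ring
    linarith
  obtain ⟨w, -, hw⟩ := exists_le_of_sum_le univ_nonempty hsum
  have hne : ∀ T ∈ B w, T.Nonempty := by
    intro T hT
    have := (mem_powersetCard.1 (mem_filter.1 (mem_filter.1 hT).1).1).2
    rw [← card_pos]; omega
  -- One vertex of each bad set is deleted. The default value is never reached, since t ≥ 1 makes
  -- bad sets nonempty.
  let f : Finset V → V := fun T => if h : T.Nonempty then h.choose else Classical.arbitrary V
  have hf : ∀ T ∈ B w, f T ∈ T := by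
    intro T hT
    simp only [f, dif_pos (hne T hT)]
    exact (hne T hT).choose_spec
  refine ⟨A w \ (B w).image f, ?_, ?_⟩
  · have h1 : #(A w) ≤ #(A w \ (B w).image f) + #(B w) := by
      have := le_card_sdiff ((B w).image f) (A w)
      have := card_image_le (s := B w) (f := f)
      omega
    have h2 : (#(A w) : ℝ) ≤ #(A w \ (B w).image f) + #(B w) := by exact_mod_cast h1
    linarith
  · intro T hT hTt
    by_contra hlt
    push Not at hlt
    have hTA : T ⊆ A w := hT.trans sdiff_subset
    have hTB : T ∈ B w := by
      simp only [B, bad, mem_filter, mem_powersetCard, subset_univ, true_and]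
      refine ⟨⟨hTt, ?_⟩, hTA⟩
      rw [Nat.card_eq_fintype_card, Fintype.card_subtype] at hlt
      exact hlt
    exact (mem_sdiff.1 (hT (hf T hTB))).2 (mem_image_of_mem f hTB)

open Finset in
/-- Iterated dependent random choice: if every set of at least `m` vertices contains a `t`-clique,
then a dense family of `r`-tuples contains a product of `t`-cliques. -/
theorem exists_prod_cliques_subset {V : Type*} [Fintype V] [Nonempty V] (G : SimpleGraph V)
    {t : ℕ} (ht : 1 ≤ t) {m : ℝ} (hm : ∀ U : Finset V, m ≤ #U → ∃ T ⊆ U, G.IsNClique t T)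
    {δ : ℕ → ℝ} {q : ℕ → ℕ} (hδ : ∀ j, 0 < δ j) (hq : ∀ j, 1 ≤ q j) (r : ℕ)
    (hV : ∀ j < r, (Fintype.card V : ℝ) ^ t * δ j ^ q j ≤ 1)
    (hU : ∀ j < r, m ≤ δ (j + 1) ^ q j * Fintype.card V - 1)
    (H : (Fin r → V) → Prop)
    (hH : δ r * (Fintype.card V : ℝ) ^ r ≤ Nat.card {x : Fin r → V // H x}) :
    ∃ T : Fin r → Finset V, (∀ i, G.IsNClique t (T i)) ∧
      ∀ x : Fin r → V, (∀ i, x i ∈ T i) → H x := by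
  induction r with
  | zero =>
    refine ⟨fun i => i.elim0, fun i => i.elim0, fun x _ => ?_⟩
    have h0 := hδ 0
    have h1 : (0 : ℝ) < Nat.card {x : Fin 0 → V // H x} := by
      refine lt_of_lt_of_le ?_ hH
      simpa using h0
    have h2 : 0 < Nat.card {x : Fin 0 → V // H x} := by exact_mod_cast h1
    obtain ⟨y, hy⟩ := (Nat.card_pos_iff.1 h2).1
    rwa [Subsingleton.elim x y]
  | succ r ih =>
    have hcard : Nat.card {p : V × (Fin r → V) // H (Fin.cons p.1 p.2)} =
        Nat.card {x : Fin (r + 1) → V // H x} :=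
      Nat.card_congr ((Fin.consEquiv fun _ => V).subtypeEquiv fun p => Iff.rfl)
    -- Peel off the first coordinate: a family of (r+1)-tuples is a bipartite relation between
    -- vertices and r-tuples. A t-clique in U then has a common neighbourhood of density δ r, to
    -- which the induction applies.
    obtain ⟨U, hUcard, hUT⟩ := exists_large_subset_of_dense
      (fun (v : V) (w : Fin r → V) => H (Fin.cons v w)) (hδ (r + 1)).le (hδ r).le (hq r) ht
      (by
        rw [hcard]
        refine le_trans (le_of_eq ?_) hH
        simp only [Fintype.card_fun, Fintype.card_fin]
        push_cast
        ring) (hV r r.lt_succ_self)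
    obtain ⟨T₀, hT₀U, hT₀⟩ := hm U ((hU r r.lt_succ_self).trans hUcard)
    obtain ⟨T, hT, hTH⟩ := ih (fun j hj => hV j (by omega)) (fun j hj => hU j (by omega))
      (fun w => ∀ v ∈ T₀, H (Fin.cons v w)) (by
        have := hUT T₀ hT₀U hT₀.card_eq
        simpa only [Fintype.card_fun, Fintype.card_fin, Nat.cast_pow] using this)
    refine ⟨Fin.cons T₀ T, ?_, ?_⟩
    · intro i
      refine Fin.cases ?_ (fun i => ?_) i
      · simpa using hT₀
      · simpa using hT i
    · intro x hx
      have h0 : x 0 ∈ T₀ := by simpa using hx 0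
      have h1 : ∀ i : Fin r, x i.succ ∈ T i := fun i => by simpa using hx i.succ
      have := hTH (fun i => x i.succ) h1 (x 0) h0
      rwa [show (Fin.cons (x 0) fun i => x i.succ : Fin (r + 1) → V) = x from Fin.cons_self_tail x]
        at this

open Finset in
/-- Pairwise completely joined cliques form a clique. -/
theorem not_cliqueFree_of_prod_cliques {V : Type*} (G : SimpleGraph V) {t r : ℕ} (ht : 1 ≤ t)
    (T : Fin r → Finset V) (hT : ∀ i, G.IsNClique t (T i))
    (hx : ∀ x : Fin r → V, (∀ i, x i ∈ T i) → ∀ i j, i ≠ j → G.Adj (x i) (x j)) :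
    ¬ G.CliqueFree (r * t) := by
  classical
  have hne : ∀ i, (T i).Nonempty := fun i => by
    rw [← card_pos, (hT i).card_eq]; omega
  choose y hy using hne
  have hadj : ∀ i j, i ≠ j → ∀ u ∈ T i, ∀ v ∈ T j, G.Adj u v := by
    intro i j hij u hu v hv
    -- A transversal through u and v: the fixed representatives y, changed at i and j only.
    have := hx (Function.update (Function.update y i u) j v) (fun l => by
      rcases eq_or_ne l j with rfl | hlj
      · simpa using hv
      · rcases eq_or_ne l i with rfl | hli
        · simpa [hlj] using hu
        · simpa [hlj, hli] using hy l) i j hij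
    simpa [hij] using this
  intro hfree
  refine hfree (univ.biUnion T) ⟨?_, ?_⟩
  · intro u hu v hv huv
    simp only [coe_biUnion, Set.mem_iUnion, mem_coe, mem_univ] at hu hv
    obtain ⟨i, -, hi⟩ := hu
    obtain ⟨j, -, hj⟩ := hv
    rcases eq_or_ne i j with rfl | hij
    · exact (hT i).isClique hi hj huv
    · exact hadj i j hij u hi v hj
  · rw [card_biUnion]
    · simp [(hT _).card_eq]
    · intro i _ j _ hij
      exact disjoint_left.2 fun u hu hv => G.loopless.irrefl u (hadj i j hij u hu u hv)

/-! ### Supersaturation for cliques -/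

/-- The number of maps whose restriction along an injection lies in a given family. -/
theorem card_restrict_along_embedding {α β V : Type*} [Fintype α] [Fintype β] [Fintype V]
    (ι : β ↪ α) (S : (β → V) → Prop) :
    Nat.card {φ : α → V // S (φ ∘ ι)} =
      Nat.card {x : β → V // S x} * Fintype.card V ^ (Fintype.card α - Fintype.card β) := by
  classical
  let e : β ⊕ ((Set.range ι)ᶜ : Set α) ≃ α :=
    ((Equiv.ofInjective ι ι.injective).sumCongr (Equiv.refl _)).trans
      (Equiv.Set.sumCompl (Set.range ι))
  have he : ∀ b, e (Sum.inl b) = ι b := fun b => by simp [e]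
  let E : (α → V) ≃ (β → V) × (((Set.range ι)ᶜ : Set α) → V) :=
    (Equiv.arrowCongr e.symm (Equiv.refl V)).trans (Equiv.sumArrowEquivProdArrow _ _ _)
  have hE : ∀ φ, (E φ).1 = φ ∘ ι := fun φ => by
    funext b
    simp [E, he]
  have h1 : {φ : α → V // S (φ ∘ ι)} ≃
      {p : (β → V) × (((Set.range ι)ᶜ : Set α) → V) // S p.1} :=
    E.subtypeEquiv fun φ => by rw [hE]
  rw [Nat.card_congr (h1.trans (Equiv.prodSubtypeFstEquivSubtypeProd (p := S))), Nat.card_prod]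
  congr 1
  rw [Nat.card_eq_fintype_card, Fintype.card_fun, Fintype.card_compl_set,
    Set.card_range_of_injective ι.injective]

theorem card_adj_pairs {V : Type*} [Fintype V] (G : SimpleGraph V) :
    Nat.card {p : V × V // G.Adj p.1 p.2} = 2 * G.edgeSet.ncard := by
  classical
  rw [← SimpleGraph.coe_edgeFinset, Set.ncard_coe_finset, ← G.sum_degrees_eq_twice_card_edges,
    Nat.card_eq_fintype_card, Fintype.card_subtype]
  simp only [Finset.card_filter]
  rw [Fintype.sum_prod_type]
  refine Finset.sum_congr rfl fun v _ => ?_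
  rw [← Finset.card_filter, ← SimpleGraph.card_neighborFinset_eq_degree,
    SimpleGraph.neighborFinset_eq_filter]

/-- Turán's theorem, counting ordered adjacent pairs. -/
theorem card_adj_pairs_le_of_cliqueFree {V : Type*} [Fintype V] (G : SimpleGraph V) {k : ℕ}
    (hk : 0 < k) (h : G.CliqueFree (k + 1)) :
    (Nat.card {p : V × V // G.Adj p.1 p.2} : ℝ) ≤ (1 - 1 / k) * (Fintype.card V : ℝ) ^ 2 := by
  classical
  obtain ⟨M, _, hM⟩ := SimpleGraph.exists_isTuranMaximal (V := V) hk
  have h1 : G.edgeFinset.card ≤ M.edgeFinset.card := hM.2 h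
  have h2 := ((SimpleGraph.isTuranMaximal_iff_nonempty_iso_turanGraph hk).mp hM).some.card_edgeFinset_eq
  have h3 := SimpleGraph.mul_card_edgeFinset_turanGraph_le (n := Fintype.card V) (r := k)
  rw [card_adj_pairs, ← SimpleGraph.coe_edgeFinset, Set.ncard_coe_finset]
  rw [← h2] at h3
  have h4 : k * (2 * G.edgeFinset.card) ≤ (k - 1) * Fintype.card V ^ 2 := by
    refine le_trans ?_ h3
    rw [← mul_assoc, mul_comm k 2]
    gcongr
  have h5 : (k : ℝ) * ((2 * G.edgeFinset.card : ℕ) : ℝ) ≤ (k - 1) * (Fintype.card V : ℝ) ^ 2 := by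
    have : ((k - 1 : ℕ) : ℝ) = k - 1 := by
      rw [Nat.cast_sub (by omega)]; simp
    rw [← this]
    exact_mod_cast h4
  have hk' : (0 : ℝ) < k := by exact_mod_cast hk
  have h6 : (1 - 1 / (k : ℝ)) * (Fintype.card V : ℝ) ^ 2 =
      ((k - 1) * (Fintype.card V : ℝ) ^ 2) / k := by field_simp
  rw [h6, le_div_iff₀ hk']
  linarith

open Finset in
/-- Supersaturation for cliques: edge density above the Turán threshold forces a positive density
of `(k + 1)`-cliques. -/
theorem exists_clique_density {k : ℕ} (hk : 0 < k) {η : ℝ} (hη : 0 < η) :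
    ∃ c : ℝ, 0 < c ∧ ∀ (n : ℕ) (G : SimpleGraph (Fin n)), 0 < n →
      (1 - 1 / k + η) * (n : ℝ) ^ 2 ≤ Nat.card {p : Fin n × Fin n // G.Adj p.1 p.2} →
      c * (n : ℝ) ^ (k + 1) ≤
        Nat.card {x : Fin (k + 1) → Fin n // ∀ i j, i ≠ j → G.Adj (x i) (x j)} := by
  classical
  -- Average over all maps from m points to the vertices. m ≥ 2/η makes the m diagonal pairs cost at
  -- most half of the excess η m², and the summand k + 2 leaves room for k + 1 points.
  obtain ⟨m₀, hm₀⟩ := exists_nat_ge (2 / η)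
  set m : ℕ := m₀ + k + 2 with hm
  have hmη : 1 ≤ m * (η / 2) := by
    have h1 : (2 / η) ≤ m := by rw [hm]; push_cast; linarith [(Nat.cast_nonneg k : (0 : ℝ) ≤ k)]
    rw [div_le_iff₀ hη] at h1
    linarith
  have hm0 : (0 : ℝ) < m := by positivity
  refine ⟨(η / 2) / m ^ (k + 1), by positivity, fun n G hn hD => ?_⟩
  have hn0 : (0 : ℝ) < n := by exact_mod_cast hn
  set D : ℕ := Nat.card {p : Fin n × Fin n // G.Adj p.1 p.2} with hDdef
  set C : ℕ := Nat.card {x : Fin (k + 1) → Fin n // ∀ i j, i ≠ j → G.Adj (x i) (x j)} with hC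
  have hDn : (D : ℝ) ≤ (n : ℝ) ^ 2 := by
    have : D ≤ n ^ 2 := by
      rw [hDdef, Nat.card_eq_fintype_card]
      refine (Fintype.card_subtype_le _).trans ?_
      simp [sq]
    exact_mod_cast this
  let P : (Fin m → Fin n) → ℕ := fun φ => #{p : Fin m × Fin m | G.Adj (φ p.1) (φ p.2)}
  let bad : Finset (Fin m → Fin n) := {φ | ¬ (G.comap φ).CliqueFree (k + 1)}
  have hpair : ∀ p : Fin m × Fin m, p.1 ≠ p.2 →
      #{φ : Fin m → Fin n | G.Adj (φ p.1) (φ p.2)} = D * n ^ (m - 2) := by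
    intro p hp
    let ι : Fin 2 ↪ Fin m := ⟨![p.1, p.2], by
      intro a b hab
      fin_cases a <;> fin_cases b <;> simp_all⟩
    have := card_restrict_along_embedding (V := Fin n) ι (fun x => G.Adj (x 0) (x 1))
    have hD2 : Nat.card {x : Fin 2 → Fin n // G.Adj (x 0) (x 1)} = D :=
      Nat.card_congr ((finTwoArrowEquiv (Fin n)).subtypeEquiv
        (q := fun p => G.Adj p.1 p.2) (fun x => Iff.rfl))
    rw [hD2] at this
    simp only [Fintype.card_fin] at this
    rw [← this, Nat.card_eq_fintype_card, Fintype.card_subtype]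
    rfl
  have hlow : (m ^ 2 - m : ℝ) * (D * n ^ (m - 2)) ≤ ∑ φ, (P φ : ℝ) := by
    have h1 : ∑ φ, P φ = ∑ p : Fin m × Fin m, #{φ : Fin m → Fin n | G.Adj (φ p.1) (φ p.2)} := by
      have := sum_card_bipartiteAbove_eq_sum_card_bipartiteBelow
        (s := (univ : Finset (Fin m → Fin n))) (t := (univ : Finset (Fin m × Fin m)))
        (fun φ p => G.Adj (φ p.1) (φ p.2))
      simpa only [bipartiteAbove, bipartiteBelow] using this
    have h2 : (m * m - m) * (D * n ^ (m - 2)) ≤ ∑ φ, P φ := by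
      rw [h1]
      calc (m * m - m) * (D * n ^ (m - 2))
          = ∑ p ∈ (univ : Finset (Fin m)).offDiag, D * n ^ (m - 2) := by
            rw [sum_const, offDiag_card]; simp
        _ = ∑ p ∈ (univ : Finset (Fin m)).offDiag,
              #{φ : Fin m → Fin n | G.Adj (φ p.1) (φ p.2)} :=
            sum_congr rfl fun p hp => (hpair p (mem_offDiag.1 hp).2.2).symm
        _ ≤ _ := sum_le_sum_of_subset (subset_univ _)
    have h3 : ((m * m - m : ℕ) : ℝ) = m ^ 2 - m := by
      rw [Nat.cast_sub (Nat.le_mul_self m)]; push_cast; ring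
    rw [← h3]
    exact_mod_cast h2
  -- Turán's bound for the pulled-back graph on m points, valid for non-injective φ too; an
  -- exceptional map is charged the trivial m².
  have hup : ∑ φ, (P φ : ℝ) ≤ (1 - 1 / k) * m ^ 2 * n ^ m + m ^ 2 * #bad := by
    have h1 : ∀ φ, (P φ : ℝ) ≤ (1 - 1 / k) * m ^ 2 + if φ ∈ bad then (m : ℝ) ^ 2 else 0 := by
      intro φ
      have hk1 : (0 : ℝ) ≤ 1 - 1 / k := by
        have : (1 : ℝ) ≤ k := by exact_mod_cast hk
        rw [sub_nonneg, div_le_one (by positivity)]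
        exact this
      by_cases hφ : φ ∈ bad
      · rw [if_pos hφ]
        have h2 : P φ ≤ m ^ 2 := by
          refine (card_le_univ _).trans ?_
          simp [sq]
        have h3 : (P φ : ℝ) ≤ (m : ℝ) ^ 2 := by exact_mod_cast h2
        have : 0 ≤ (1 - 1 / (k : ℝ)) * m ^ 2 := by positivity
        linarith
      · rw [if_neg hφ, add_zero]
        have hfree : (G.comap φ).CliqueFree (k + 1) := by
          by_contra h
          exact hφ (by simp [bad, h])
        have := card_adj_pairs_le_of_cliqueFree _ hk hfree
        rw [Nat.card_eq_fintype_card, Fintype.card_subtype] at this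
        simpa [P] using this
    refine (sum_le_sum fun φ _ => h1 φ).trans (le_of_eq ?_)
    rw [sum_add_distrib, sum_const, card_univ, sum_ite_mem, univ_inter, sum_const]
    simp only [Fintype.card_fun, Fintype.card_fin, nsmul_eq_mul]
    push_cast
    ring
  -- Union bound over the at most m^(k+1) positions of a clique among the m points.
  have hbad : (#bad : ℝ) ≤ m ^ (k + 1) * (C * n ^ (m - (k + 1))) := by
    have h1 : bad ⊆ (univ : Finset (Fin (k + 1) ↪ Fin m)).biUnion fun ι =>
        {φ : Fin m → Fin n | ∀ i j, i ≠ j → G.Adj ((φ ∘ ι) i) ((φ ∘ ι) j)} := by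
      intro φ hφ
      have hφ' : ¬ (G.comap φ).CliqueFree (k + 1) := by simpa [bad] using hφ
      let f := SimpleGraph.topEmbeddingOfNotCliqueFree hφ'
      simp only [mem_biUnion, mem_univ, true_and, mem_filter]
      refine ⟨f.toEmbedding, fun i j hij => ?_⟩
      exact f.map_rel_iff.2 ((SimpleGraph.top_adj i j).2 hij)
    have h2 : #bad ≤ m ^ (k + 1) * (C * n ^ (m - (k + 1))) := by
      refine (card_le_card h1).trans (card_biUnion_le.trans ?_)
      calc ∑ ι : Fin (k + 1) ↪ Fin m,
            #{φ : Fin m → Fin n | ∀ i j, i ≠ j → G.Adj ((φ ∘ ι) i) ((φ ∘ ι) j)}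
          = ∑ ι : Fin (k + 1) ↪ Fin m, C * n ^ (m - (k + 1)) := by
            refine sum_congr rfl fun ι _ => ?_
            have := card_restrict_along_embedding (V := Fin n) ι
              (fun x => ∀ i j, i ≠ j → G.Adj (x i) (x j))
            simp only [Fintype.card_fin] at this
            rw [hC, ← this, Nat.card_eq_fintype_card, Fintype.card_subtype]
        _ ≤ _ := by
            rw [sum_const, card_univ, smul_eq_mul]
            gcongr
            have := Fintype.card_le_of_injective
              (fun (ι : Fin (k + 1) ↪ Fin m) => (ι : Fin (k + 1) → Fin m)) DFunLike.coe_injective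
            simpa using this
    exact_mod_cast h2
  have hnm : (n : ℝ) ^ m = n ^ 2 * n ^ (m - 2) := by
    rw [← pow_add]; congr 1; omega
  have hnm' : (n : ℝ) ^ m = n ^ (k + 1) * n ^ (m - (k + 1)) := by
    rw [← pow_add]; congr 1; omega
  have hmain : (η / 2) * (n : ℝ) ^ m ≤ #bad := by
    have h1 := hlow.trans hup
    have h2 : (1 - 1 / k + η) * (n : ℝ) ^ m ≤ D * n ^ (m - 2) := by
      rw [hnm, ← mul_assoc]; gcongr
    have h3 : (D : ℝ) * n ^ (m - 2) ≤ n ^ m := by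
      rw [hnm]; gcongr
    have h4 : (m : ℝ) ^ 2 * ((η / 2) * (n : ℝ) ^ m) ≤ m ^ 2 * #bad := by
      have h5 : (m : ℝ) ^ 2 * ((1 - 1 / k + η) * (n : ℝ) ^ m) ≤ m ^ 2 * (D * n ^ (m - 2)) := by
        gcongr
      have h6 : (m : ℝ) * (D * n ^ (m - 2)) ≤ m * (m * (η / 2)) * n ^ m := by
        have : (m : ℝ) * (D * n ^ (m - 2)) ≤ m * (1 * n ^ m) := by rw [one_mul]; gcongr
        refine this.trans ?_
        rw [mul_assoc (m : ℝ)]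
        gcongr
      nlinarith
    exact le_of_mul_le_mul_left h4 (by positivity)
  have h7 := hmain.trans hbad
  rw [hnm', ← mul_assoc, ← mul_assoc] at h7
  have h8 := le_of_mul_le_mul_right h7 (by positivity)
  rw [div_mul_eq_mul_div, div_le_iff₀ (by positivity)]
  linarith

/-! ### Disjoint copies of a graph -/

namespace SimpleGraph

theorem indepNum_le_of_embedding {V W : Type*} [Finite V] [Finite W] {G : SimpleGraph V}
    {H : SimpleGraph W} (f : G ↪g H) : G.indepNum ≤ H.indepNum := by
  obtain ⟨S, hS⟩ := G.exists_isNIndepSet_indepNum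
  rw [← hS.card_eq, ← Finset.card_map f.toEmbedding]
  refine IsIndepSet.card_le_indepNum ?_
  intro u hu v hv huv
  simp only [Finset.coe_map, Set.mem_image, Finset.mem_coe] at hu hv
  obtain ⟨a, ha, rfl⟩ := hu
  obtain ⟨b, hb, rfl⟩ := hv
  have hab : a ≠ b := fun h => huv (by rw [h])
  exact fun h => hS.isIndepSet ha hb hab (f.map_rel_iff.1 h)

/-- The disjoint union of `j` copies of a graph. -/
def copies {V : Type*} (ι : Type*) (G : SimpleGraph V) : SimpleGraph (ι × V) where
  Adj p q := p.1 = q.1 ∧ G.Adj p.2 q.2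
  symm := ⟨fun _ _ h => ⟨h.1.symm, h.2.symm⟩⟩
  loopless := ⟨fun _ h => G.loopless.irrefl _ h.2⟩

theorem copies_exists_isNClique {V ι : Type*} {G : SimpleGraph V} {n : ℕ} {S : Finset (ι × V)}
    (hS : (copies ι G).IsNClique n S) : ∃ T : Finset V, G.IsNClique n T := by
  classical
  refine ⟨S.image Prod.snd, ?_, ?_⟩
  · intro u hu v hv huv
    simp only [Finset.coe_image, Set.mem_image, Finset.mem_coe] at hu hv
    obtain ⟨a, ha, rfl⟩ := hu
    obtain ⟨b, hb, rfl⟩ := hv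
    exact (hS.isClique ha hb (fun h => huv (by rw [h]))).2
  · rw [Finset.card_image_of_injOn, hS.card_eq]
    intro a ha b hb hab
    by_contra hne
    exact (hS.isClique ha hb hne).2.ne hab

theorem copies_card_le_of_isIndepSet {V ι : Type*} [Fintype V] [Fintype ι] {G : SimpleGraph V}
    {S : Finset (ι × V)} (hS : (copies ι G).IsIndepSet S) :
    S.card ≤ Fintype.card ι * G.indepNum := by
  classical
  rw [mul_comm]
  refine Finset.card_le_mul_card_image_of_maps_to (f := fun a : ι × V => a.1)
    (fun _ _ => Finset.mem_univ _) _ ?_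
  intro i _
  have hinj : Set.InjOn Prod.snd ((S.filter fun a => a.1 = i : Finset (ι × V)) : Set (ι × V)) := by
    intro a ha b hb hab
    have ha' := (Finset.mem_filter.1 ha).2
    have hb' := (Finset.mem_filter.1 hb).2
    exact Prod.ext (ha'.trans hb'.symm) hab
  rw [← Finset.card_image_of_injOn hinj]
  refine IsIndepSet.card_le_indepNum ?_
  intro u hu v hv huv
  simp only [Finset.coe_image, Set.mem_image, Finset.mem_coe, Finset.mem_filter] at hu hv
  obtain ⟨a, ⟨ha, hai⟩, rfl⟩ := hu
  obtain ⟨b, ⟨hb, hbi⟩, rfl⟩ := hv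
  exact fun h => hS ha hb (fun h => huv (by rw [h])) ⟨hai.trans hbi.symm, h⟩

end SimpleGraph

/-! ### The inverse Ramsey function -/

theorem ramseyQ_le_indepNum {V : Type*} [Fintype V] {t n : ℕ} (hV : Fintype.card V = n)
    {G : SimpleGraph V} (hG : G.CliqueFree t) : ramseyQ t n ≤ G.indepNum := by
  let e : V ≃ Fin n := Fintype.equivFinOfCardEq hV
  let f : G.comap e.symm ↪g G := SimpleGraph.Embedding.comap e.symm.toEmbedding G
  refine le_trans (Nat.sInf_le ⟨G.comap e.symm, hG.comap f.isContained, rfl⟩) ?_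
  exact SimpleGraph.indepNum_le_of_embedding f

theorem exists_ramseyQ {t : ℕ} (ht : 2 ≤ t) (n : ℕ) :
    ∃ G : SimpleGraph (Fin n), G.CliqueFree t ∧ G.indepNum = ramseyQ t n :=
  Nat.sInf_mem (s := {a : ℕ | ∃ G : SimpleGraph (Fin n), G.CliqueFree t ∧ G.indepNum = a})
    ⟨_, ⊥, SimpleGraph.cliqueFree_bot ht, rfl⟩

theorem ramseyQ_card_le_indepNum {V : Type*} [Fintype V] {t : ℕ} {G : SimpleGraph V} (U : Finset V)
    (hU : ∀ T ⊆ U, ¬ G.IsNClique t T) : ramseyQ t U.card ≤ G.indepNum := by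
  let f : G.induce (U : Set V) ↪g G := SimpleGraph.Embedding.induce _
  refine le_trans (ramseyQ_le_indepNum (G := G.induce (U : Set V)) (by simp) ?_)
    (SimpleGraph.indepNum_le_of_embedding f)
  intro T hT
  refine hU (T.map f.toEmbedding) ?_ ?_
  · intro v hv
    obtain ⟨u, -, rfl⟩ := Finset.mem_map.1 hv
    exact u.2
  · refine ⟨?_, by rw [Finset.card_map, hT.card_eq]⟩
    intro u hu v hv huv
    simp only [Finset.coe_map, Set.mem_image, Finset.mem_coe] at hu hv
    obtain ⟨a, ha, rfl⟩ := hu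
    obtain ⟨b, hb, rfl⟩ := hv
    exact f.map_rel_iff.2 (hT.isClique ha hb (fun h => huv (by rw [h])))

/-- `Q(t, ·)` is monotone and subadditive. -/
theorem ramseyQ_le_mul {t : ℕ} (ht : 2 ≤ t) {n j a : ℕ} (h : n ≤ j * a) :
    ramseyQ t n ≤ j * ramseyQ t a := by
  obtain ⟨G, hG, hGa⟩ := exists_ramseyQ ht a
  -- Any n vertices of j disjoint copies of an extremal graph on a vertices.
  obtain ⟨U, -, hU⟩ := Finset.exists_subset_card_eq (s := (Finset.univ : Finset (Fin j × Fin a)))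
    (n := n) (by simpa using h)
  have h1 : ramseyQ t U.card ≤ (SimpleGraph.copies (Fin j) G).indepNum :=
    ramseyQ_card_le_indepNum U fun T _ hT => by
      obtain ⟨T', hT'⟩ := SimpleGraph.copies_exists_isNClique hT
      exact hG T' hT'
  rw [hU] at h1
  obtain ⟨S, hS⟩ := (SimpleGraph.copies (Fin j) G).exists_isNIndepSet_indepNum
  refine h1.trans ?_
  rw [← hS.card_eq, ← hGa]
  simpa using SimpleGraph.copies_card_le_of_isIndepSet hS.isIndepSet

/-- Ramsey's theorem for two colours. -/
theorem exists_ramsey_bound (l m : ℕ) : ∃ N : ℕ, ∀ (n : ℕ) (G : SimpleGraph (Fin n))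
    (U : Finset (Fin n)), N ≤ U.card →
      (∃ S ⊆ U, G.IsNClique l S) ∨ (∃ S ⊆ U, G.IsNIndepSet m S) := by
  classical
  induction l generalizing m with
  | zero => exact ⟨0, fun n G U _ => Or.inl ⟨∅, by simp, by simp⟩⟩
  | succ l ihl =>
    induction m with
    | zero => exact ⟨0, fun n G U _ => Or.inr ⟨∅, by simp, ⟨by simp, by simp⟩⟩⟩
    | succ m ihm =>
      obtain ⟨N₁, h₁⟩ := ihl (m + 1)
      obtain ⟨N₂, h₂⟩ := ihm
      refine ⟨N₁ + N₂ + 1, fun n G U hU => ?_⟩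
      obtain ⟨v, hv⟩ : U.Nonempty := by rw [← Finset.card_pos]; omega
      have hcard := Finset.card_filter_add_card_filter_not (s := U.erase v) (fun u => G.Adj v u)
      rw [Finset.card_erase_of_mem hv] at hcard
      rcases (by omega : N₁ ≤ ((U.erase v).filter fun u => G.Adj v u).card ∨
        N₂ ≤ ((U.erase v).filter fun u => ¬ G.Adj v u).card) with h | h
      · rcases h₁ n G _ h with ⟨S, hSU, hS⟩ | ⟨S, hSU, hS⟩
        · refine Or.inl ⟨insert v S, ?_, hS.insert fun b hb => (Finset.mem_filter.1 (hSU hb)).2⟩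
          exact Finset.insert_subset hv fun b hb =>
            Finset.mem_of_mem_erase (Finset.mem_filter.1 (hSU hb)).1
        · exact Or.inr ⟨S, fun b hb => Finset.mem_of_mem_erase (Finset.mem_filter.1 (hSU hb)).1, hS⟩
      · rcases h₂ n G _ h with ⟨S, hSU, hS⟩ | ⟨S, hSU, hS⟩
        · exact Or.inl ⟨S, fun b hb => Finset.mem_of_mem_erase (Finset.mem_filter.1 (hSU hb)).1, hS⟩
        · refine Or.inr ⟨insert v S, ?_, ?_⟩
          · exact Finset.insert_subset hv fun b hb =>
              Finset.mem_of_mem_erase (Finset.mem_filter.1 (hSU hb)).1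
          · rw [← SimpleGraph.isNClique_compl] at hS ⊢
            refine hS.insert fun b hb => ?_
            have hb' := Finset.mem_filter.1 (hSU hb)
            exact (SimpleGraph.compl_adj _ _ _).2 ⟨(Finset.ne_of_mem_erase hb'.1).symm, hb'.2⟩

theorem exists_forall_le_ramseyQ {t : ℕ} (ht : 2 ≤ t) (m : ℕ) :
    ∃ N : ℕ, ∀ n ≥ N, m ≤ ramseyQ t n := by
  obtain ⟨N, hN⟩ := exists_ramsey_bound t m
  refine ⟨N, fun n hn => ?_⟩
  obtain ⟨G, hG, hGn⟩ := exists_ramseyQ ht n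
  rcases hN n G Finset.univ (by simpa using hn) with ⟨S, -, hS⟩ | ⟨S, -, hS⟩
  · exact absurd hS (hG S)
  · rw [← hGn, ← hS.card_eq]
    exact hS.isIndepSet.card_le_indepNum

/-- Otherwise Q(t, ·) would stay bounded along k^j (N + 1), contradicting Ramsey's theorem. The
strict increase is needed because the Ramsey–Turán function demands an independence number strictly
below its argument. -/
theorem exists_ramseyQ_lt_ramseyQ_mul {t k : ℕ} (ht : 2 ≤ t) (hk : 2 ≤ k) (N : ℕ) :
    ∃ m ≥ N, 0 < m ∧ ramseyQ t m < ramseyQ t (k * m) := by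
  by_contra! hcon
  have h1 : ∀ j, ramseyQ t (k ^ j * (N + 1)) ≤ ramseyQ t (N + 1) := by
    intro j
    induction j with
    | zero => simp
    | succ j ih =>
      have hpos : 0 < k ^ j := by positivity
      have := hcon (k ^ j * (N + 1)) (by nlinarith) (by positivity)
      rw [pow_succ', mul_assoc]
      exact this.trans ih
  obtain ⟨M, hM⟩ := exists_forall_le_ramseyQ ht (ramseyQ t (N + 1) + 1)
  have h2 : M ≤ k ^ M * (N + 1) := by
    have := (Nat.lt_pow_self (n := M) (by omega : 1 < k)).le
    nlinarith
  have := hM _ h2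
  have := h1 M
  omega

/-! ### Elementary properties of Ramsey–Turán densities -/

theorem edgeSet_ncard_le_sq {n : ℕ} (G : SimpleGraph (Fin n)) : G.edgeSet.ncard ≤ n ^ 2 := by
  classical
  have h1 := card_adj_pairs G
  have h2 : Nat.card {p : Fin n × Fin n // G.Adj p.1 p.2} ≤ n ^ 2 := by
    rw [Nat.card_eq_fintype_card]
    refine (Fintype.card_subtype_le _).trans ?_
    simp [sq]
  omega

theorem edgeSet_ncard_le_ramseyTuran {V : Type*} [Fintype V] {n s : ℕ} (hV : Fintype.card V = n)
    {G : SimpleGraph V} {x : ℝ} (hG : G.CliqueFree s) (hα : (G.indepNum : ℝ) < x) :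
    G.edgeSet.ncard ≤ ramseyTuran n (⊤ : SimpleGraph (Fin s)) x := by
  classical
  let e : V ≃ Fin n := Fintype.equivFinOfCardEq hV
  let f : G.comap e.symm ≃g G := SimpleGraph.Iso.comap e.symm G
  refine le_csSup ⟨n ^ 2, ?_⟩ ⟨G.comap e.symm, ?_, ?_, ?_⟩
  · rintro _ ⟨G', -, -, rfl⟩
    exact edgeSet_ncard_le_sq G'
  · have h1 := hG.comap f.toEmbedding.isContained
    have := SimpleGraph.cliqueFree_iff_top_free (G := G.comap e.symm) (β := Fin s)
    rw [Fintype.card_fin] at this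
    exact this.1 h1
  · refine lt_of_le_of_lt ?_ hα
    exact_mod_cast SimpleGraph.indepNum_le_of_embedding f.toEmbedding
  · rw [← Nat.card_coe_set_eq, ← Nat.card_coe_set_eq]
    exact Nat.card_congr f.mapEdgeSet

theorem ramseyTuran_le {n s b : ℕ} {x : ℝ}
    (h : ∀ G : SimpleGraph (Fin n), G.CliqueFree s → (G.indepNum : ℝ) < x → G.edgeSet.ncard ≤ b) :
    ramseyTuran n (⊤ : SimpleGraph (Fin s)) x ≤ b := by
  refine csSup_le' ?_
  rintro _ ⟨G, hG, hα, rfl⟩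
  refine h G ?_ hα
  have := SimpleGraph.cliqueFree_iff_top_free (G := G) (β := Fin s)
  rw [Fintype.card_fin] at this
  exact this.2 hG

theorem ramseyTuran_div_sq_nonneg (s n : ℕ) (x : ℝ) :
    0 ≤ (ramseyTuran n (⊤ : SimpleGraph (Fin s)) x : ℝ) / (n : ℝ) ^ 2 := by positivity

theorem ramseyTuran_div_sq_le_one (s n : ℕ) (x : ℝ) :
    (ramseyTuran n (⊤ : SimpleGraph (Fin s)) x : ℝ) / (n : ℝ) ^ 2 ≤ 1 := by
  refine div_le_one_of_le₀ ?_ (by positivity)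
  exact_mod_cast ramseyTuran_le fun G _ _ => edgeSet_ncard_le_sq G

theorem isBoundedUnder_le_ramseyTuran (s : ℕ) (f : ℕ → ℝ) :
    IsBoundedUnder (· ≤ ·) atTop
      (fun n : ℕ => (ramseyTuran n (⊤ : SimpleGraph (Fin s)) (f n) : ℝ) / (n : ℝ) ^ 2) :=
  isBoundedUnder_of ⟨1, fun n => ramseyTuran_div_sq_le_one s n (f n)⟩

theorem isBoundedUnder_ge_ramseyTuran (s : ℕ) (f : ℕ → ℝ) :
    IsBoundedUnder (· ≥ ·) atTop
      (fun n : ℕ => (ramseyTuran n (⊤ : SimpleGraph (Fin s)) (f n) : ℝ) / (n : ℝ) ^ 2) :=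
  isBoundedUnder_of ⟨0, fun n => ramseyTuran_div_sq_nonneg s n (f n)⟩

theorem lowerRTDensity_le_upperRTDensity (s : ℕ) (f : ℕ → ℝ) :
    lowerRTDensity (⊤ : SimpleGraph (Fin s)) f ≤ upperRTDensity (⊤ : SimpleGraph (Fin s)) f :=
  liminf_le_limsup (isBoundedUnder_le_ramseyTuran s f) (isBoundedUnder_ge_ramseyTuran s f)

theorem le_upperRTDensity_of_frequently {s : ℕ} {f : ℕ → ℝ} {c : ℝ}
    (h : ∃ᶠ n : ℕ in atTop, c ≤ (ramseyTuran n (⊤ : SimpleGraph (Fin s)) (f n) : ℝ) / (n : ℝ) ^ 2) :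
    c ≤ upperRTDensity (⊤ : SimpleGraph (Fin s)) f :=
  le_limsup_of_frequently_le h (isBoundedUnder_le_ramseyTuran s f)

theorem upperRTDensity_le_of_eventually {s : ℕ} {f : ℕ → ℝ} {c : ℝ}
    (h : ∀ᶠ n : ℕ in atTop, (ramseyTuran n (⊤ : SimpleGraph (Fin s)) (f n) : ℝ) / (n : ℝ) ^ 2 ≤ c) :
    upperRTDensity (⊤ : SimpleGraph (Fin s)) f ≤ c :=
  limsup_le_of_le (isBoundedUnder_ge_ramseyTuran s f).isCoboundedUnder_le h

theorem upperRTDensity_nonneg (s : ℕ) (f : ℕ → ℝ) :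
    0 ≤ upperRTDensity (⊤ : SimpleGraph (Fin s)) f :=
  le_upperRTDensity_of_frequently
    (Frequently.of_forall fun n => ramseyTuran_div_sq_nonneg s n (f n))

/-- A `K_t`-free graph of independence number below `Q(t, n)` does not exist. -/
theorem upperRTDensity_ramseyQ_of_le {s t : ℕ} (hst : s ≤ t) :
    upperRTDensity (⊤ : SimpleGraph (Fin s)) (fun n => (ramseyQ t n : ℝ)) ≤ 0 := by
  refine upperRTDensity_le_of_eventually (Eventually.of_forall fun n => ?_)
  have : ramseyTuran n (⊤ : SimpleGraph (Fin s)) (ramseyQ t n : ℝ) ≤ 0 := by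
    refine ramseyTuran_le fun G hG hα => ?_
    have h1 := ramseyQ_le_indepNum (Fintype.card_fin n) (hG.mono hst)
    have h2 : G.indepNum < ramseyQ t n := by exact_mod_cast hα
    omega
  simp [Nat.le_zero.1 this]

/-! ### Lower bound by complete joins -/

/-- The complete join of `k` copies of an extremal `K_{t+1}`-free graph. -/
theorem ramseyTuran_join_lower_bound {s t k m : ℕ} (ht : 2 ≤ t + 1) (hs : k * t + 1 ≤ s) {x : ℝ}
    (hx : (ramseyQ (t + 1) m : ℝ) < x) :
    k * (k - 1) * m ^ 2 ≤ 2 * ramseyTuran (k * m) (⊤ : SimpleGraph (Fin s)) x := by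
  classical
  obtain ⟨G, hG, hα⟩ := exists_ramseyQ ht m
  -- The join is the complement of disjoint copies of the complement, so the facts on copies apply
  -- with cliques and independent sets exchanged.
  let J : SimpleGraph (Fin k × Fin m) := (SimpleGraph.copies (Fin k) Gᶜ)ᶜ
  have hJ : J.CliqueFree s := by
    intro S hS
    have h1 : (SimpleGraph.copies (Fin k) Gᶜ).IsIndepSet S := by
      have := hS.isClique
      rwa [SimpleGraph.isClique_compl] at this
    have h2 := SimpleGraph.copies_card_le_of_isIndepSet h1
    obtain ⟨T, hT⟩ := Gᶜ.exists_isNIndepSet_indepNum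
    rw [← SimpleGraph.isNClique_compl, compl_compl] at hT
    have h3 : Gᶜ.indepNum ≤ t := by
      by_contra hlt
      exact hG.mono (by omega : t + 1 ≤ Gᶜ.indepNum) T hT
    rw [hS.card_eq, Fintype.card_fin] at h2
    have := Nat.mul_le_mul_left k h3
    omega
  have hJα : J.indepNum ≤ ramseyQ (t + 1) m := by
    obtain ⟨S, hS⟩ := J.exists_isNIndepSet_indepNum
    rw [← SimpleGraph.isNClique_compl, compl_compl] at hS
    obtain ⟨T, hT⟩ := SimpleGraph.copies_exists_isNClique hS
    rw [SimpleGraph.isNClique_compl] at hT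
    rw [← hα, ← hT.card_eq]
    exact hT.isIndepSet.card_le_indepNum
  have hJx : (J.indepNum : ℝ) < x := lt_of_le_of_lt (by exact_mod_cast hJα) hx
  refine le_trans ?_ (Nat.mul_le_mul_left 2
    (edgeSet_ncard_le_ramseyTuran (n := k * m) (by simp) hJ hJx))
  rw [← card_adj_pairs]
  have h1 : Nat.card {p : (Fin k × Fin k) × (Fin m × Fin m) // p.1.1 ≠ p.1.2} ≤
      Nat.card {p : (Fin k × Fin m) × (Fin k × Fin m) // J.Adj p.1 p.2} := by
    refine Nat.card_le_card_of_injective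
      (fun p => ⟨((p.1.1.1, p.1.2.1), (p.1.1.2, p.1.2.2)), ?_⟩) ?_
    · refine (SimpleGraph.compl_adj _ _ _).2 ⟨fun h => p.2 (congrArg Prod.fst h), fun h => p.2 h.1⟩
    · rintro ⟨⟨⟨a, b⟩, c, d⟩, _⟩ ⟨⟨⟨a', b'⟩, c', d'⟩, _⟩ h
      simp only [Subtype.mk.injEq, Prod.mk.injEq] at h ⊢
      tauto
  refine le_trans (le_of_eq ?_) h1
  rw [Nat.card_congr (Equiv.prodSubtypeFstEquivSubtypeProd (p := fun q : Fin k × Fin k => q.1 ≠ q.2)),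
    Nat.card_prod]
  have h2 : Nat.card {q : Fin k × Fin k // q.1 ≠ q.2} = k * (k - 1) := by
    have h3 : (Finset.univ.filter fun q : Fin k × Fin k => q.1 ≠ q.2) =
        (Finset.univ : Finset (Fin k)).offDiag := by ext; simp
    rw [Nat.card_eq_fintype_card, Fintype.card_subtype, h3, Finset.offDiag_card]
    simp [Nat.mul_sub]
  rw [h2]
  simp [sq]

theorem le_upperRTDensity_ramseyQ {s t k : ℕ} (ht : 2 ≤ t + 1) (hk : 0 < k) (hs : k * t + 1 ≤ s) :
    (1 - 1 / (k : ℝ)) / 2 ≤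
      upperRTDensity (⊤ : SimpleGraph (Fin s)) (fun n => (ramseyQ (t + 1) n : ℝ)) := by
  rcases (by omega : k = 1 ∨ 2 ≤ k) with rfl | hk2
  · simpa using upperRTDensity_nonneg s _
  refine le_upperRTDensity_of_frequently (frequently_atTop.2 fun N => ?_)
  obtain ⟨m, hmN, hm, hlt⟩ := exists_ramseyQ_lt_ramseyQ_mul ht hk2 N
  refine ⟨k * m, hmN.trans (Nat.le_mul_of_pos_left m hk), ?_⟩
  have h1 := ramseyTuran_join_lower_bound (x := (ramseyQ (t + 1) (k * m) : ℝ)) ht hs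
    (by exact_mod_cast hlt)
  have h2 : (k : ℝ) * (k - 1) * m ^ 2 ≤
      2 * ramseyTuran (k * m) (⊤ : SimpleGraph (Fin s)) (ramseyQ (t + 1) (k * m) : ℝ) := by
    have : ((k - 1 : ℕ) : ℝ) = k - 1 := by rw [Nat.cast_sub hk]; simp
    rw [← this]
    exact_mod_cast h1
  have hk' : (0 : ℝ) < k := by exact_mod_cast hk
  have hm' : (0 : ℝ) < m := by exact_mod_cast hm
  rw [le_div_iff₀ (by push_cast; positivity)]
  push_cast
  calc (1 - 1 / (k : ℝ)) / 2 * (k * m) ^ 2 = (k * (k - 1) * m ^ 2) / 2 := by field_simp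
    _ ≤ _ := by linarith

/-! ### Upper bound by dependent random choice -/

/-- If `n / 2 ^ A ≤ |U|` and the independence number is below `Q(t, n) / 2 ^ (A + 1)`, then `U`
contains a `t`-clique. -/
theorem exists_isNClique_subset_of_indepNum_lt {n t : ℕ} (ht : 2 ≤ t) (hn : 0 < n)
    {G : SimpleGraph (Fin n)} {A φ : ℝ} (hφ : φ ≤ (2 : ℝ) ^ (-(A + 1)))
    (hα : (G.indepNum : ℝ) < φ * ramseyQ t n) (U : Finset (Fin n))
    (hU : (n : ℝ) * (2 : ℝ) ^ (-A) ≤ U.card) : ∃ T ⊆ U, G.IsNClique t T := by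
  by_contra! hcon
  have h1 : (ramseyQ t U.card : ℝ) ≤ G.indepNum := by exact_mod_cast ramseyQ_card_le_indepNum U hcon
  have hn' : (0 : ℝ) < n := by exact_mod_cast hn
  have hu : (0 : ℝ) < U.card := lt_of_lt_of_le (by positivity) hU
  have hun : (U.card : ℝ) ≤ n := by
    have := U.card_le_univ
    rw [Fintype.card_fin] at this
    exact_mod_cast this
  -- Rounding up costs at most a factor 2, as n/|U| ≥ 1; this is the +1 in the exponent A + 1.
  set j : ℕ := ⌈(n : ℝ) / U.card⌉₊ with hj
  have hnj : n ≤ j * U.card := by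
    have h2 : (n : ℝ) / U.card ≤ j := Nat.le_ceil _
    rw [div_le_iff₀ hu] at h2
    exact_mod_cast h2
  have h3 : (ramseyQ t n : ℝ) ≤ j * ramseyQ t U.card := by exact_mod_cast ramseyQ_le_mul ht hnj
  have h4 : (j : ℝ) ≤ 2 * ((n : ℝ) / U.card) := by
    have h5 : (1 : ℝ) ≤ (n : ℝ) / U.card := by rw [le_div_iff₀ hu]; linarith
    have h6 : (j : ℝ) < (n : ℝ) / U.card + 1 := Nat.ceil_lt_add_one (by positivity)
    linarith
  have h7 : (n : ℝ) / U.card * (2 : ℝ) ^ (-A) ≤ 1 := by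
    rw [div_mul_eq_mul_div, div_le_one hu]
    exact hU
  have h8 : (2 : ℝ) ^ (-(A + 1)) = (2 : ℝ) ^ (-A) / 2 := by
    rw [neg_add, Real.rpow_add two_pos, Real.rpow_neg_one]; ring
  have h9 : (2 : ℝ) ^ (-(A + 1)) * j ≤ 1 := by
    rw [h8]
    have : (0 : ℝ) < (2 : ℝ) ^ (-A) := by positivity
    calc (2 : ℝ) ^ (-A) / 2 * j ≤ (2 : ℝ) ^ (-A) / 2 * (2 * ((n : ℝ) / U.card)) := by gcongr
      _ = (n : ℝ) / U.card * (2 : ℝ) ^ (-A) := by ring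
      _ ≤ 1 := h7
  have h10 : φ * ramseyQ t n ≤ ramseyQ t U.card := by
    calc φ * ramseyQ t n ≤ (2 : ℝ) ^ (-(A + 1)) * (j * ramseyQ t U.card) := by gcongr
      _ = ((2 : ℝ) ^ (-(A + 1)) * j) * ramseyQ t U.card := by ring
      _ ≤ 1 * ramseyQ t U.card := by gcongr
      _ = _ := one_mul _
  linarith

/-- A dense family of `r`-tuples of vertices spanning cliques yields a clique on `r * t` vertices,
provided that the independence number is small enough. -/
theorem not_cliqueFree_of_dense_tuples {n t r : ℕ} (ht : 2 ≤ t) (hr : 0 < r) {C φ : ℝ} (hC : 1 ≤ C)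
    (hn : 2 ≤ n) {L : ℝ} (hL : L = Real.logb 2 n)
    (hlarge : (2 * t * C + 1) * L ^ (1 - 1 / (r : ℝ)) ≤ L)
    (hφ : φ ≤ (2 : ℝ) ^ (-((2 * t * C + 2) * L ^ (1 - 1 / (r : ℝ)))))
    {G : SimpleGraph (Fin n)} (hα : (G.indepNum : ℝ) < φ * ramseyQ t n)
    (hG : (2 : ℝ) ^ (-C) * (n : ℝ) ^ r ≤
      Nat.card {x : Fin r → Fin n // ∀ i j, i ≠ j → G.Adj (x i) (x j)}) :
    ¬ G.CliqueFree (r * t) := by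
  have hn0 : (0 : ℝ) < n := by positivity
  have hL1 : 1 ≤ L := by
    rw [hL, Real.le_logb_iff_rpow_le one_lt_two hn0, Real.rpow_one]
    exact_mod_cast hn
  have hL0 : 0 < L := by linarith
  have hnL : (n : ℝ) = (2 : ℝ) ^ L := by
    rw [hL, Real.rpow_logb two_pos (by norm_num) hn0]
  have hr' : (0 : ℝ) < r := by exact_mod_cast hr
  have ht' : (2 : ℝ) ≤ t := by exact_mod_cast ht
  have : Nonempty (Fin n) := ⟨⟨0, by omega⟩⟩
  set β : ℝ := 1 - 1 / (r : ℝ) with hβ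
  have hβ0 : 0 ≤ β := by
    rw [hβ, sub_nonneg, div_le_one hr']; exact_mod_cast hr
  have hLβ : 1 ≤ L ^ β := Real.one_le_rpow hL1 hβ0
  -- The densities fall from 2^{-C} at a = r to n^{-C} at a = 0, the exponent gaining a factor
  -- L^{1/r} per round. With q a ≈ t L^{a/r}, δ_a^{q_a} ≤ n^{-t} kills the bad t-sets, while
  -- δ_{a+1}^{q_a} ≥ 2^{-2tC L^{1-1/r}} keeps U large. This balance produces the exponent 1 - 1/r.
  let δ : ℕ → ℝ := fun a => (2 : ℝ) ^ (-(C * L ^ (((r : ℝ) - a) / r)))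
  let q : ℕ → ℕ := fun a => ⌈t * L ^ ((a : ℝ) / r)⌉₊
  have hqa : ∀ a : ℕ, 1 ≤ (t : ℝ) * L ^ ((a : ℝ) / r) := fun a => by
    have : 1 ≤ L ^ ((a : ℝ) / r) := Real.one_le_rpow hL1 (by positivity)
    nlinarith
  have hq1 : ∀ a : ℕ, (t : ℝ) * L ^ ((a : ℝ) / r) ≤ q a := fun a => Nat.le_ceil _
  have hq2 : ∀ a : ℕ, (q a : ℝ) ≤ 2 * (t * L ^ ((a : ℝ) / r)) := fun a => by
    have h1 : (q a : ℝ) < t * L ^ ((a : ℝ) / r) + 1 := Nat.ceil_lt_add_one (by positivity)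
    linarith [hqa a]
  have hrich : ∀ U : Finset (Fin n), (n : ℝ) * (2 : ℝ) ^ (-((2 * t * C + 1) * L ^ β)) ≤ U.card →
      ∃ T ⊆ U, G.IsNClique t T := by
    intro U hU
    refine exists_isNClique_subset_of_indepNum_lt ht (by omega) (hφ.trans ?_) hα U hU
    refine Real.rpow_le_rpow_of_exponent_le one_le_two (neg_le_neg ?_)
    nlinarith
  obtain ⟨T, hT, hTx⟩ := exists_prod_cliques_subset G (by omega : 1 ≤ t) hrich
    (δ := δ) (q := q) (fun _ => by positivity)
    (fun a => by
      have := (hqa a).trans (hq1 a)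
      exact_mod_cast this) r
    (fun a ha => by
      rw [Fintype.card_fin, hnL, ← Real.rpow_natCast, ← Real.rpow_mul two_pos.le,
        ← Real.rpow_natCast, ← Real.rpow_mul two_pos.le, ← Real.rpow_add two_pos]
      refine Real.rpow_le_one_of_one_le_of_nonpos one_le_two ?_
      have h1 : L ^ (((r : ℝ) - a) / r) * L ^ ((a : ℝ) / r) = L := by
        rw [← Real.rpow_add hL0, ← add_div, sub_add_cancel, div_self hr'.ne', Real.rpow_one]
      have h2 : L * t ≤ C * L ^ (((r : ℝ) - a) / r) * q a := by
        calc L * t = 1 * L ^ (((r : ℝ) - a) / r) * (t * L ^ ((a : ℝ) / r)) := by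
              linear_combination (-(t : ℝ)) * h1
          _ ≤ C * L ^ (((r : ℝ) - a) / r) * q a := by
              gcongr
              exact hq1 a
      linarith)
    (fun a ha => by
      have h1 : L ^ (((r : ℝ) - (a + 1 : ℕ)) / r) * L ^ ((a : ℝ) / r) = L ^ β := by
        rw [← Real.rpow_add hL0]
        congr 1
        rw [hβ]
        push_cast
        field_simp
        ring
      have h2 : (2 : ℝ) ^ (-((2 * t * C) * L ^ β)) ≤ δ (a + 1) ^ q a := by
        rw [← Real.rpow_natCast, ← Real.rpow_mul two_pos.le]
        refine Real.rpow_le_rpow_of_exponent_le one_le_two ?_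
        have h3 : C * L ^ (((r : ℝ) - (a + 1 : ℕ)) / r) * q a ≤ 2 * t * C * L ^ β := by
          calc C * L ^ (((r : ℝ) - (a + 1 : ℕ)) / r) * q a
              ≤ C * L ^ (((r : ℝ) - (a + 1 : ℕ)) / r) * (2 * (t * L ^ ((a : ℝ) / r))) := by
                gcongr
                exact hq2 a
            _ = 2 * t * C * L ^ β := by linear_combination (2 * t * C : ℝ) * h1
        linarith
      rw [Fintype.card_fin]
      have h4 : (n : ℝ) * (2 : ℝ) ^ (-((2 * t * C) * L ^ β)) ≤ δ (a + 1) ^ q a * n := by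
        rw [mul_comm]; gcongr
      -- Since the main term is at least 2, subtracting 1 at most halves it: this turns 2tC into 2tC
      -- + 1. The further unit in 2tC + 2 pays for the rounding in `hrich`.
      have h5 : (2 : ℝ) ≤ n * (2 : ℝ) ^ (-((2 * t * C) * L ^ β)) := by
        rw [hnL, ← Real.rpow_add two_pos]
        calc (2 : ℝ) = (2 : ℝ) ^ (1 : ℝ) := (Real.rpow_one 2).symm
          _ ≤ _ := Real.rpow_le_rpow_of_exponent_le one_le_two (by linarith)
      have h6 : (2 : ℝ) ^ (-((2 * t * C + 1) * L ^ β)) ≤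
          (2 : ℝ) ^ (-((2 * t * C) * L ^ β)) * (1 / 2) := by
        have : (1 / 2 : ℝ) = (2 : ℝ) ^ (-1 : ℝ) := by rw [Real.rpow_neg_one]; norm_num
        rw [this, ← Real.rpow_add two_pos]
        exact Real.rpow_le_rpow_of_exponent_le one_le_two (by linarith)
      have h7 := mul_le_mul_of_nonneg_left h6 hn0.le
      linarith)
    (fun x => ∀ i j, i ≠ j → G.Adj (x i) (x j))
    (by
      refine le_trans (le_of_eq ?_) hG
      simp [δ])
  exact not_cliqueFree_of_prod_cliques G (by omega) T hT hTx

/-- All A are required because the constant C depends on the clique density c, which degenerates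
with the excess η. -/
theorem upperRTDensity_le_of_small {s t k : ℕ} (ht : 2 ≤ t) (hk : 0 < k) (hs : s ≤ (k + 1) * t)
    {φ : ℕ → ℝ} (hφ : ∀ A : ℝ, ∀ᶠ n : ℕ in atTop,
      φ n ≤ (2 : ℝ) ^ (-(A * Real.logb 2 n ^ (1 - 1 / ((k + 1 : ℕ) : ℝ))))) :
    upperRTDensity (⊤ : SimpleGraph (Fin s)) (fun n => φ n * (ramseyQ t n : ℝ)) ≤
      (1 - 1 / (k : ℝ)) / 2 := by
  refine le_of_forall_pos_le_add fun η hη => ?_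
  -- The excess doubles to 2η because ordered pairs are counted.
  obtain ⟨c, hc, hcG⟩ := exists_clique_density hk (mul_pos two_pos hη)
  set C : ℝ := max 1 (-Real.logb 2 c) with hCdef
  have hCc : (2 : ℝ) ^ (-C) ≤ c := by
    rw [← Real.le_logb_iff_rpow_le one_lt_two hc]
    linarith [le_max_right 1 (-Real.logb 2 c)]
  have hlog : Tendsto (fun n : ℕ => Real.logb 2 (n : ℝ)) atTop atTop :=
    (Real.tendsto_logb_atTop one_lt_two).comp tendsto_natCast_atTop_atTop
  have hγ : (0 : ℝ) < 1 / ((k + 1 : ℕ) : ℝ) := by positivity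
  have hpow := ((tendsto_rpow_atTop hγ).comp hlog).eventually_ge_atTop (2 * t * C + 1)
  refine upperRTDensity_le_of_eventually ?_
  filter_upwards [hφ (2 * t * C + 2), hpow, eventually_ge_atTop 2] with n hφn hLn hn
  have hk1 : (0 : ℝ) ≤ 1 - 1 / k := by
    have : (1 : ℝ) ≤ k := by exact_mod_cast hk
    rw [sub_nonneg, div_le_one (by positivity)]
    exact this
  have hn0 : (0 : ℝ) < n := by positivity
  rw [div_le_iff₀ (by positivity)]
  refine le_trans ?_ (Nat.floor_le (by positivity))
  refine Nat.cast_le.2 (ramseyTuran_le fun G hG hα => Nat.le_floor ?_)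
  by_contra! hlt
  have hL0 : 0 < Real.logb 2 n := Real.logb_pos one_lt_two (by exact_mod_cast hn)
  have hcl := hcG n G (by omega) (by
    rw [card_adj_pairs]
    push_cast
    linarith)
  refine not_cliqueFree_of_dense_tuples ht k.succ_pos (le_max_left 1 _ : 1 ≤ C) hn rfl ?_ hφn hα
    ?_ (hG.mono hs)
  · calc (2 * t * C + 1) * Real.logb 2 n ^ (1 - 1 / ((k + 1 : ℕ) : ℝ))
        ≤ Real.logb 2 n ^ (1 / ((k + 1 : ℕ) : ℝ)) *
            Real.logb 2 n ^ (1 - 1 / ((k + 1 : ℕ) : ℝ)) := by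
          gcongr
          exact hLn
      _ = Real.logb 2 n := by
          rw [← Real.rpow_add hL0, add_sub_cancel, Real.rpow_one]
  · refine le_trans ?_ hcl
    gcongr

/-! ### The main theorem -/

theorem mainTheorem11 (s t : ℕ) (ht : 2 ≤ t)
    (hgap : RamseyGap (t + 1))
    (hpt : HasPhaseTransition (⊤ : SimpleGraph (Fin s))
      (fun n : ℕ => (ramseyQ t n : ℝ)) (fun n : ℕ => (ramseyQ (t + 1) n : ℝ))) :
    (∃ ε : ℝ, 0 < ε ∧ ε < 1 ∧ ∀ ω : ℕ → ℝ, Tendsto ω atTop atTop →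
      HasPhiPhaseTransition (⊤ : SimpleGraph (Fin s)) (phiEps ω ε)
        (fun n : ℕ => (ramseyQ t n : ℝ)) ∧
      ¬ HasPhaseTransition (⊤ : SimpleGraph (Fin s))
        (fun n : ℕ => phiEps ω ε n * (ramseyQ t n : ℝ))
        (fun n : ℕ => (ramseyQ (t + 1) n : ℝ))) ∧
    HasWeakPhaseTransition (⊤ : SimpleGraph (Fin s)) (fun n : ℕ => (ramseyQ t n : ℝ)) := by
  -- If s ≤ t, no graph is admissible at Q(t, n), so the density there is 0 and cannot drop.
  have hst : t < s := by
    by_contra! h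
    have h1 := (lowerRTDensity_le_upperRTDensity s _).trans (upperRTDensity_ramseyQ_of_le h)
    have h2 := upperRTDensity_nonneg s (fun n => (ramseyQ (t + 1) n : ℝ))
    exact absurd hpt (not_lt.2 (h1.trans h2))
  set k : ℕ := (s - 1) / t with hkdef
  have hk : 0 < k := Nat.div_pos (by omega) (by omega)
  have hks : k * t + 1 ≤ s := by
    have : k * t ≤ s - 1 := Nat.div_mul_le_self (s - 1) t
    omega
  have hsk : s ≤ (k + 1) * t := by
    have h1 : t * k + (s - 1) % t = s - 1 := Nat.div_add_mod (s - 1) t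
    have h2 := Nat.mod_lt (s - 1) (by omega : 0 < t)
    rw [add_mul, one_mul, mul_comm k t]
    omega
  set ε : ℝ := 1 / ((k + 1 : ℕ) : ℝ) with hε
  have hε0 : 0 < ε := by positivity
  have hε1 : ε < 1 := by
    rw [hε, div_lt_one (by positivity)]
    exact_mod_cast (by omega : 1 < k + 1)
  have hlow := le_upperRTDensity_ramseyQ (by omega : 2 ≤ t + 1) hk hks
  have hlog : Tendsto (fun n : ℕ => Real.logb 2 (n : ℝ)) atTop atTop :=
    (Real.tendsto_logb_atTop one_lt_two).comp tendsto_natCast_atTop_atTop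
  have hpowε : Tendsto (fun n : ℕ => Real.logb 2 (n : ℝ) ^ (1 - ε)) atTop atTop :=
    (tendsto_rpow_atTop (sub_pos.2 hε1)).comp hlog
  have hexp : ∀ g : ℕ → ℝ, Tendsto g atTop atTop →
      Tendsto (fun n => (2 : ℝ) ^ (-(g n))) atTop (𝓝 0) := fun g hg => by
    have h := (tendsto_rpow_atBot_of_base_gt_one 2 one_lt_two).comp
      (tendsto_neg_atTop_atBot.comp hg)
    exact h
  have hsmall : ∀ ω : ℕ → ℝ, Tendsto ω atTop atTop →
      Tendsto (phiEps ω ε) atTop (𝓝 0) ∧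
      upperRTDensity (⊤ : SimpleGraph (Fin s)) (fun n => phiEps ω ε n * (ramseyQ t n : ℝ)) ≤
        (1 - 1 / (k : ℝ)) / 2 := by
    intro ω hω
    refine ⟨hexp _ (hω.atTop_mul_atTop₀ hpowε), upperRTDensity_le_of_small ht hk hsk fun A => ?_⟩
    filter_upwards [hω.eventually_ge_atTop A, hpowε.eventually_ge_atTop 0] with n hA hpos
    refine Real.rpow_le_rpow_of_exponent_le one_le_two (neg_le_neg ?_)
    exact mul_le_mul_of_nonneg_right hA hpos
  -- The weak transition uses ε/2: (log n)^{1-ε/2} equals (log n)^{ε/2} (log n)^{1-ε}, and the first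
  -- factor exceeds every constant A.
  refine ⟨⟨ε, hε0, hε1, fun ω hω => ⟨⟨(hsmall ω hω).1, ?_⟩, ?_⟩⟩, ε / 2, half_pos hε0, ?_, ?_⟩
  · exact lt_of_le_of_lt ((hsmall ω hω).2.trans hlow) hpt
  · exact not_lt.2 ((lowerRTDensity_le_upperRTDensity s _).trans ((hsmall ω hω).2.trans hlow))
  · exact hexp _ ((tendsto_rpow_atTop (by linarith)).comp hlog)
  · refine lt_of_le_of_lt (le_trans ?_ hlow) hpt
    refine upperRTDensity_le_of_small ht hk hsk fun A => ?_
    filter_upwards [((tendsto_rpow_atTop (half_pos hε0)).comp hlog).eventually_ge_atTop A,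
      hpowε.eventually_ge_atTop 0, hlog.eventually_gt_atTop 0] with n hA hpos hL
    refine Real.rpow_le_rpow_of_exponent_le one_le_two (neg_le_neg ?_)
    calc A * Real.logb 2 n ^ (1 - ε)
        ≤ Real.logb 2 n ^ (ε / 2) * Real.logb 2 n ^ (1 - ε) := mul_le_mul_of_nonneg_right hA hpos
      _ = Real.logb 2 n ^ (1 - ε / 2) := by
        rw [← Real.rpow_add hL]
        congr 1
        ring
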